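/- Let $n\ge 1$, let $D^{2n}$ be the closed unit ball in $\mathbb R^{2n}=\{(\mathbf q,\mathbf p)\}$ with the standard symplectic form $\omega=\sum_{i=1}^n dq_i\wedge dp_i$. A symplectomorphism of $D^{2n}$ is a $C^\infty$ diffeomorphism $D^{2n}\to D^{2n}$ preserving $\omega$. For every neighborhood $\mathcal V$, in the $C^\infty$ topology on smooth maps $[0,1]\times D^{2n}\to\mathbb R^{2n}$, of the trivial family $(t,x)\mapsto x$, there is a neighborhood $\mathcal U$ of the identity, in the $C^\infty$ topology on smooth maps $D^{2n}\to\mathbb R^{2n}$, such that the following holds. Let $\varphi_0\in\mathcal U$ be a symplectomorphism of $D^{2n}$ that coincides with the identity in a neighborhood of the boundary $\partial D^{2n}$. Then there is a family $\{\varphi_t\}_{t\in[0,1]}$ of symplectomorphisms of $D^{2n}$, smooth in the sense that $(t,x)\mapsto\varphi_t(x)$ is $C^\infty$ on $[0,1]\times D^{2n}$, such that 1. there is a neighborhood of $\partial D^{2n}$ in $D^{2n}$ on which $\varphi_t$ is the identity for all $t\in[0,1]$; 2. $\varphi_t=\varphi_0$ for all $t\in[0,\frac13]$ and $\varphi_t=\mathrm{id}$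 for all $t\in[\frac23,1]$; 3. the map $(t,x)\mapsto\varphi_t(x)$ belongs to $\mathcal V$. Here the $C^\infty$ topology is that of uniform convergence of all partial derivatives: a neighborhood basis of $g$ is given by the sets of those $f$ for which all derivatives of $f-g$ of orders $0,\dots,k$ have norm less than $\varepsilon$ at every point, with $k\in\mathbb N$ and $\varepsilon>0$. -/

import Mathlib

open Set Topology
open scoped ContDiff

namespace SymplecticDisc

/-- The space `ℝ²ⁿ` with its Euclidean norm; the coordinates with index `Sum.inl i` are `qᵢ`, those
with index `Sum.inr i` are `pᵢ`. -/
abbrev Space (n : ℕ) : Type := EuclideanSpace ℝ (Fin n ⊕ Fin n)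

/-- The disc `D²ⁿ`: the closed unit ball of `ℝ²ⁿ`. -/
abbrev disc (n : ℕ) : Set (Space n) := Metric.closedBall 0 1

/-- The boundary of `D²ⁿ`: the unit sphere. -/
abbrev bdry (n : ℕ) : Set (Space n) := Metric.sphere 0 1

/-- The standard symplectic form `∑ dqᵢ ∧ dpᵢ` on `ℝ²ⁿ`. -/
def omega {n : ℕ} (u v : Space n) : ℝ :=
  ∑ i : Fin n, (u (Sum.inl i) * v (Sum.inr i) - u (Sum.inr i) * v (Sum.inl i))

/-- `φ` restricts to a symplectomorphism of `D²ⁿ`: a smooth bijection of the closed disc onto itself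
with smooth inverse, whose differential preserves the symplectic form at every point of the disc.
The values of `φ` outside the disc are irrelevant. -/
structure IsSymplectomorphism {n : ℕ} (φ : Space n → Space n) : Prop where
  mapsTo : MapsTo φ (disc n) (disc n)
  smooth : ContDiffOn ℝ ∞ φ (disc n)
  exists_smooth_inverse : ∃ ψ : Space n → Space n,
    MapsTo ψ (disc n) (disc n) ∧ ContDiffOn ℝ ∞ ψ (disc n) ∧ InvOn ψ φ (disc n) (disc n)
  preserves_omega : ∀ x ∈ disc n, ∀ u v : Space n,
    omega (fderivWithin ℝ φ (disc n) x u) (fderivWithin ℝ φ (disc n) x v) = omega u v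

/-- All derivatives of `f - g` of order `0, …, k` have norm less than `ε` at every point of `s`.
For compact `s` and smooth `f`, `g` on `s`, the sets `{f | CkClose k ε s f g}`, with `k : ℕ` and
`ε > 0`, form a neighborhood basis of `g` in the `C^∞` topology. -/
def CkClose {E F : Type*} [NormedAddCommGroup E] [NormedSpace ℝ E]
    [NormedAddCommGroup F] [NormedSpace ℝ F]
    (k : ℕ) (ε : ℝ) (s : Set E) (f g : E → F) : Prop :=
  ∀ j ≤ k, ∀ x ∈ s, ‖iteratedFDerivWithin ℝ j (fun y => f y - g y) s x‖ < ε

end SymplecticDisc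

/-! Write `φ₀ = id + u`, with `u` extended by zero outside the disc, and set `φ_t = (id + s u) ∘ (id
+ r u)⁻¹` with `r + s = 1`. For `A = Du`, the pullback of `ω` by `id + c u` is `ω + c L + c² Q`,
where `L(a, b) = ω(Aa, b) + ω(a, Ab)` and `Q(a, b) = ω(Aa, Ab)`. Since `φ₀` is symplectic, `L = -Q`,
so the pullback is `ω - c(1 - c) Q`, which is unchanged under `c ↦ 1 - c`. Hence `id + s u` and `id
+ r u` pull `ω` back to the same form, and `φ_t` is symplectic
(`isSymplectomorphism_interpolation`). Moving `r` from `0` to `1/2` leads from `φ₀` to the identity.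

Smallness follows from `φ_t(x) - x = (s - r) u((id + r u)⁻¹ x)`: the derivatives of the inverse are
bounded uniformly (`exists_bound_iteratedFDeriv_inverse`) and those of `u` are small. -/

/-! ### Perturbations of the identity and derivative estimates. -/

/-- A smooth perturbation of the identity of slope at most `1/2` is a diffeomorphism. -/
theorem exists_contDiff_inverse_id_add {E : Type*} [NormedAddCommGroup E] [NormedSpace ℝ E]
    [CompleteSpace E] {W : E → E} (hW : ContDiff ℝ ∞ W) (hb : ∀ x, ‖fderiv ℝ W x‖ ≤ 1 / 2) :
    ∃ Γ : E → E, ContDiff ℝ ∞ Γ ∧ (∀ x, Γ (x + W x) = x) ∧ ∀ x, Γ x + W (Γ x) = x := by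
  -- The identity operator has norm `1` only on a nontrivial space.
  rcases subsingleton_or_nontrivial E with hE | hE
  · exact ⟨id, contDiff_id, fun x => Subsingleton.elim _ _, fun x => Subsingleton.elim _ _⟩
  have hWd : Differentiable ℝ W := hW.differentiable (by simp)
  have hlip : LipschitzWith (1 / 2) W :=
    lipschitzWith_of_nnnorm_fderiv_le hWd fun x => by
      rw [← NNReal.coe_le_coe]; simpa using hb x
  have happ : ApproximatesLinearOn (fun x => x + W x)
      ((ContinuousLinearEquiv.refl ℝ E : E ≃L[ℝ] E) : E →L[ℝ] E) univ (1 / 2) := by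
    rw [ApproximatesLinearOn.approximatesLinearOn_iff_lipschitzOnWith, lipschitzOnWith_univ]
    convert hlip using 1
    ext x; simp
  have hc : (1 / 2 : NNReal) <
      ‖((ContinuousLinearEquiv.refl ℝ E).symm : E →L[ℝ] E)‖₊⁻¹ := by
    have : ‖((ContinuousLinearEquiv.refl ℝ E).symm : E →L[ℝ] E)‖₊ = 1 := by
      simp
    rw [this, ← NNReal.coe_lt_coe]
    norm_num
  let e := happ.toHomeomorph (fun x => x + W x) (Or.inr hc)
  have he : ∀ x, e x = x + W x := fun x => rfl
  have hunit : ∀ x, IsUnit (1 - -fderiv ℝ W x : E →L[ℝ] E) := fun x =>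
    isUnit_one_sub_of_norm_lt_one (by rw [norm_neg]; linarith [hb x])
  refine ⟨e.symm, e.contDiff_symm (f₀' := fun x => ContinuousLinearEquiv.ofUnit (hunit x).unit)
    (fun x => ?_) (contDiff_id.add hW), fun x => e.symm_apply_apply x, fun x => ?_⟩
  · have h := (hasFDerivAt_id x).add (hWd x).hasFDerivAt
    have h' : ((ContinuousLinearEquiv.ofUnit (hunit x).unit : E ≃L[ℝ] E) : E →L[ℝ] E) =
        ContinuousLinearMap.id ℝ E + fderiv ℝ W x := by
      ext v
      change (1 - -fderiv ℝ W x : E →L[ℝ] E) v = _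
      simp
    rw [h']
    exact h
  · rw [← he]; exact e.apply_symm_apply x

/-- Uniform bounds on the derivatives of the inverses of perturbations of the identity. -/
theorem exists_bound_iteratedFDeriv_inverse (E : Type*) [NormedAddCommGroup E] [NormedSpace ℝ E]
    (k : ℕ) : ∃ C : ℝ, 1 ≤ C ∧ ∀ W Γ : E → E, ContDiff ℝ ∞ W → ContDiff ℝ ∞ Γ →
      (∀ x, Γ x + W (Γ x) = x) →
      (∀ j ≤ k + 1, ∀ x, ‖iteratedFDeriv ℝ j W x‖ ≤ 1 / 2) →
      ∀ i, 1 ≤ i → i ≤ k → ∀ x, ‖iteratedFDeriv ℝ i Γ x‖ ≤ C := by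
  induction k with
  | zero => exact ⟨1, le_rfl, fun _ _ _ _ _ _ i h1 h2 => by omega⟩
  | succ k ih =>
    obtain ⟨C, hC1, hC⟩ := ih
    have hC0 : 0 ≤ C := by linarith
    -- `S` bounds the Leibniz terms containing only lower derivatives of `Γ`; `2 * (1 + S)` comes
    -- from solving `d ≤ 1 + (d / 2 + S)` for `d`.
    set S : ℝ := ∑ j ∈ Finset.range k,
      (k.choose (j + 1) : ℝ) * ((j + 1).factorial * (1 / 2) * C ^ (j + 1)) * C with hS
    refine ⟨max C (2 * (1 + S)), le_max_of_le_left hC1, fun W Γ hW hΓ hinv hb i hi1 hik x => ?_⟩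
    have hΓC := hC W Γ hW hΓ hinv fun j hj => hb j (by omega)
    rcases Nat.lt_or_ge i (k + 1) with hi | hi
    · exact (hΓC i hi1 (by omega) x).trans (le_max_left _ _)
    obtain rfl : i = k + 1 := le_antisymm hik hi
    refine le_trans ?_ (le_max_right _ _)
    have hDW : ContDiff ℝ ∞ (fderiv ℝ W) := hW.fderiv_right (by simp)
    have hDΓ : ContDiff ℝ ∞ (fderiv ℝ Γ) := hΓ.fderiv_right (by simp)
    have hcomp : ContDiff ℝ ∞ (fun y => fderiv ℝ W (Γ y)) := hDW.comp hΓ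
    let B := ContinuousLinearMap.compL ℝ E E E
    have hbil : ContDiff ℝ ∞ (fun y => B (fderiv ℝ W (Γ y)) (fderiv ℝ Γ y)) :=
      hcomp.clm_comp hDΓ
    -- Differentiating `Γ + W ∘ Γ = id`. In the `k`-th derivative of the right side, the top
    -- derivative of `Γ` appears only multiplied by `DW`, of norm at most `1/2`, so it can be
    -- absorbed on the left.
    have heq : fderiv ℝ Γ = fun y => ContinuousLinearMap.id ℝ E -
        B (fderiv ℝ W (Γ y)) (fderiv ℝ Γ y) := by
      funext y
      have hd : HasFDerivAt Γ (fderiv ℝ Γ y) y :=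
        (hΓ.differentiable (by simp) y).hasFDerivAt
      have hw : HasFDerivAt W (fderiv ℝ W (Γ y)) (Γ y) :=
        (hW.differentiable (by simp) (Γ y)).hasFDerivAt
      have h1 := hd.add (hw.comp y hd)
      have h2 : (Γ + W ∘ Γ) = id := funext hinv
      rw [h2] at h1
      exact eq_sub_of_add_eq (h1.unique (hasFDerivAt_id y))
    have hid : ‖iteratedFDeriv ℝ k (fun _ : E => ContinuousLinearMap.id ℝ E) x‖ ≤ 1 := by
      rcases Nat.eq_zero_or_pos k with rfl | hk
      · simpa using ContinuousLinearMap.norm_id_le (𝕜 := ℝ) (E := E)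
      · rw [iteratedFDeriv_const_of_ne hk.ne']; simp
    have hsum : ‖iteratedFDeriv ℝ k (fun y => B (fderiv ℝ W (Γ y)) (fderiv ℝ Γ y)) x‖ ≤
        1 / 2 * ‖iteratedFDeriv ℝ (k + 1) Γ x‖ + S := by
      refine (B.norm_iteratedFDeriv_le_of_bilinear_of_le_one hcomp hDΓ x (n := k)
        (mod_cast le_top) (ContinuousLinearMap.norm_compL_le ℝ E E E)).trans ?_
      rw [Finset.sum_range_succ', add_comm, hS]
      refine add_le_add ?_ (Finset.sum_le_sum fun j hj => ?_)
      · have h1 := hb 1 (by omega) (Γ x)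
        rw [norm_iteratedFDeriv_one] at h1
        rw [norm_iteratedFDeriv_zero, Nat.sub_zero, norm_iteratedFDeriv_fderiv]
        simp only [Nat.choose_zero_right, Nat.cast_one, one_mul]
        gcongr
      · rw [Finset.mem_range] at hj
        have h1 : ‖iteratedFDeriv ℝ (j + 1) (fderiv ℝ W ∘ Γ) x‖ ≤
            (j + 1).factorial * (1 / 2) * C ^ (j + 1) :=
          norm_iteratedFDeriv_comp_le hDW hΓ (mod_cast le_top) x
            (fun i hi => by rw [norm_iteratedFDeriv_fderiv]; exact hb _ (by omega) _)
            fun i hi1 hi => (hΓC i hi1 (by omega) x).trans (le_self_pow₀ hC1 (by omega))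
        have h2 : ‖iteratedFDeriv ℝ (k - (j + 1)) (fderiv ℝ Γ) x‖ ≤ C := by
          rw [norm_iteratedFDeriv_fderiv]
          exact hΓC _ (by omega) (by omega) x
        have h3 : ‖iteratedFDeriv ℝ (j + 1) (fun y => fderiv ℝ W (Γ y)) x‖ ≤ _ := h1
        gcongr
    have hmain : ‖iteratedFDeriv ℝ (k + 1) Γ x‖ ≤
        1 + (1 / 2 * ‖iteratedFDeriv ℝ (k + 1) Γ x‖ + S) := by
      conv_lhs => rw [← norm_iteratedFDeriv_fderiv, heq]
      rw [fun_iteratedFDeriv_sub_apply contDiffAt_const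
        (hbil.of_le (mod_cast le_top)).contDiffAt]
      exact (norm_sub_le _ _).trans (add_le_add hid hsum)
    linarith

theorem norm_iteratedFDeriv_comp_clm_le {E G H : Type*} [NormedAddCommGroup E] [NormedSpace ℝ E]
    [NormedAddCommGroup G] [NormedSpace ℝ G] [NormedAddCommGroup H] [NormedSpace ℝ H]
    {L : E →L[ℝ] G} (hL : ‖L‖ ≤ 1) {f : G → H} (hf : ContDiff ℝ ∞ f) (i : ℕ) (x : E) :
    ‖iteratedFDeriv ℝ i (f ∘ L) x‖ ≤ ‖iteratedFDeriv ℝ i f (L x)‖ := by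
  rw [L.iteratedFDeriv_comp_right hf x (mod_cast le_top)]
  refine (ContinuousMultilinearMap.norm_compContinuousLinearMap_le _ _).trans ?_
  exact mul_le_of_le_one_right (norm_nonneg _)
    (Finset.prod_le_one (fun _ _ => norm_nonneg _) fun _ _ => hL)

/-- Derivatives of a product `ρ(t) • u(x)` in separated variables. -/
theorem norm_iteratedFDeriv_fst_smul_snd_le {E F : Type*} [NormedAddCommGroup E] [NormedSpace ℝ E]
    [NormedAddCommGroup F] [NormedSpace ℝ F] {ρ : ℝ → ℝ} {u : E → F}
    (hρ : ContDiff ℝ ∞ ρ) (hu : ContDiff ℝ ∞ u) {k : ℕ} {R δ : ℝ}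
    (hR : ∀ j ≤ k, ∀ t, ‖iteratedFDeriv ℝ j ρ t‖ ≤ R)
    (hδ : ∀ j ≤ k, ∀ x, ‖iteratedFDeriv ℝ j u x‖ ≤ δ) {j : ℕ} (hj : j ≤ k) (p : ℝ × E) :
    ‖iteratedFDeriv ℝ j (fun p : ℝ × E => ρ p.1 • u p.2) p‖ ≤ 2 ^ j * (R * δ) := by
  have hR0 : 0 ≤ R := (norm_nonneg _).trans (hR 0 (by omega) 0)
  have hρ' : ContDiff ℝ ∞ (fun p : ℝ × E => ρ p.1) := hρ.comp contDiff_fst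
  have hu' : ContDiff ℝ ∞ (fun p : ℝ × E => u p.2) := hu.comp contDiff_snd
  have h1 : ∀ i ≤ k, ‖iteratedFDeriv ℝ i (fun p : ℝ × E => ρ p.1) p‖ ≤ R := fun i hi =>
    (norm_iteratedFDeriv_comp_clm_le (L := ContinuousLinearMap.fst ℝ ℝ E)
      (ContinuousLinearMap.norm_fst_le ..) hρ i p).trans (hR i hi _)
  have h2 : ∀ i ≤ k, ‖iteratedFDeriv ℝ i (fun p : ℝ × E => u p.2) p‖ ≤ δ := fun i hi =>
    (norm_iteratedFDeriv_comp_clm_le (L := ContinuousLinearMap.snd ℝ ℝ E)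
      (ContinuousLinearMap.norm_snd_le ..) hu i p).trans (hδ i hi _)
  have h3 := norm_iteratedFDeriv_smul_le hρ' hu' p (n := j) (mod_cast le_top)
  refine h3.trans ?_
  have h4 : (∑ i ∈ Finset.range (j + 1), (j.choose i : ℝ)) = 2 ^ j := by
    exact_mod_cast Nat.sum_range_choose j
  rw [← h4, Finset.sum_mul]
  refine Finset.sum_le_sum fun i hi => ?_
  rw [Finset.mem_range] at hi
  rw [mul_assoc]
  exact mul_le_mul_of_nonneg_left (mul_le_mul (h1 i (by omega)) (h2 _ (by omega))
    (norm_nonneg _) hR0) (Nat.cast_nonneg _)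

theorem exists_bound_iteratedFDeriv_of_hasCompactSupport {E F : Type*} [NormedAddCommGroup E]
    [NormedSpace ℝ E] [NormedAddCommGroup F] [NormedSpace ℝ F] {f : E → F} (hf : ContDiff ℝ ∞ f)
    (hc : HasCompactSupport f) (k : ℕ) :
    ∃ R : ℝ, 0 ≤ R ∧ ∀ j ≤ k, ∀ x, ‖iteratedFDeriv ℝ j f x‖ ≤ R := by
  choose R hR using fun j : ℕ => (hf.continuous_iteratedFDeriv (m := j) (mod_cast le_top)
    ).bounded_above_of_compact_support (hc.iteratedFDeriv j)
  refine ⟨∑ j ∈ Finset.range (k + 1), |R j|, Finset.sum_nonneg fun _ _ => abs_nonneg _,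
    fun j hj x => (hR j x).trans ((le_abs_self _).trans ?_)⟩
  exact Finset.single_le_sum (f := fun j => |R j|) (fun _ _ => abs_nonneg _)
    (Finset.mem_range.2 (by omega))

/-! ### Displacements supported in the disc and symplectic interpolation. -/

namespace SymplecticDisc

variable {n : ℕ}

theorem uniqueDiffOn_disc : UniqueDiffOn ℝ (disc n) :=
  uniqueDiffOn_convex (convex_closedBall _ _)
    ⟨0, interior_mono Metric.ball_subset_closedBall
      (by rw [Metric.isOpen_ball.interior_eq]; simp)⟩

/-- The displacement of a map that is the identity near the boundary extends by zero. -/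
theorem exists_contDiff_displacement {φ₀ : Space n → Space n} (hs : ContDiffOn ℝ ∞ φ₀ (disc n))
    {U : Set (Space n)} (hU : U ∈ 𝓝ˢ (bdry n)) (hφ : EqOn φ₀ id (U ∩ disc n)) :
    ∃ u : Space n → Space n, ContDiff ℝ ∞ u ∧ EqOn u (fun x => φ₀ x - x) (disc n) ∧
      ∀ x ∉ disc n, u x = 0 := by
  classical
  refine ⟨fun x => if x ∈ disc n then φ₀ x - x else 0, contDiff_iff_contDiffAt.2 fun x => ?_,
    fun x hx => if_pos hx, fun x hx => if_neg hx⟩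
  rcases lt_trichotomy (dist x 0) 1 with h | h | h
  · have hn : disc n ∈ 𝓝 x := Metric.closedBall_mem_nhds_of_mem h
    refine ((hs.contDiffAt hn).sub contDiffAt_id).congr_of_eventuallyEq ?_
    filter_upwards [hn] with y hy using if_pos hy
  · have hn : U ∈ 𝓝 x := mem_nhdsSet_iff_forall.1 hU x h
    refine (contDiffAt_const (c := (0 : Space n))).congr_of_eventuallyEq ?_
    filter_upwards [hn] with y hy
    split_ifs with hd
    · rw [hφ ⟨hy, hd⟩, id, sub_self]
    · rfl
  · have hn : (disc n)ᶜ ∈ 𝓝 x :=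
      Metric.isClosed_closedBall.isOpen_compl.mem_nhds fun h' => absurd h (not_lt.2 h')
    refine (contDiffAt_const (c := (0 : Space n))).congr_of_eventuallyEq ?_
    filter_upwards [hn] with y hy using if_neg hy

theorem iteratedFDeriv_eq_zero_of_notMem_disc {u : Space n → Space n} (h0 : ∀ x ∉ disc n, u x = 0)
    {x : Space n} (hx : x ∉ disc n) (j : ℕ) : iteratedFDeriv ℝ j u x = 0 := by
  have h : u =ᶠ[𝓝 x] fun _ => 0 := by
    filter_upwards [Metric.isClosed_closedBall.isOpen_compl.mem_nhds hx] with y hy using h0 y hy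
  rw [(h.iteratedFDeriv ℝ j).self_of_nhds, iteratedFDeriv_fun_zero, Pi.zero_apply]

theorem omega_add_smul (a b A B : Space n) (c : ℝ) :
    omega (a + c • A) (b + c • B) =
      omega a b + c * (omega A b + omega a B) + c ^ 2 * omega A B := by
  simp only [omega, PiLp.add_apply, PiLp.smul_apply, smul_eq_mul, Finset.mul_sum,
    ← Finset.sum_add_distrib]
  exact Finset.sum_congr rfl fun i _ => by ring

/-- A point `y = x + W x` outside the disc would be fixed by `id + W`, as is visible from `W y = 0`;
injectivity then forces `y = x`. -/
theorem mapsTo_disc_id_add {W Γ : Space n → Space n} (h0 : ∀ x ∉ disc n, W x = 0)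
    (hinv : ∀ x, Γ (x + W x) = x) : MapsTo (fun x => x + W x) (disc n) (disc n) := by
  intro x hx
  by_contra h
  have h1 := hinv (x + W x)
  rw [h0 _ h, add_zero, hinv] at h1
  exact h (Eq.subst (motive := (· ∈ disc n)) h1 hx)

theorem mapsTo_disc_inverse_id_add {W Γ : Space n → Space n} (h0 : ∀ x ∉ disc n, W x = 0)
    (hinv : ∀ x, Γ x + W (Γ x) = x) : MapsTo Γ (disc n) (disc n) := by
  intro x hx
  by_contra h
  have h1 := hinv x
  rw [h0 _ h, add_zero] at h1
  exact h (h1.symm ▸ hx)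

/-- If `id + u` is symplectic and `r + s = 1`, then so is `(id + s u) ∘ (id + r u)⁻¹`. -/
theorem isSymplectomorphism_interpolation {u g : Space n → Space n} (hu : ContDiff ℝ ∞ u)
    (h0 : ∀ x ∉ disc n, u x = 0) (hb : ∀ x, ‖fderiv ℝ u x‖ ≤ 1 / 2)
    (hω : ∀ x a b, omega (fderiv ℝ u x a) b + omega a (fderiv ℝ u x b) +
      omega (fderiv ℝ u x a) (fderiv ℝ u x b) = 0)
    {r s : ℝ} (hs0 : 0 ≤ s) (hs1 : s ≤ 1) (hrs : r + s = 1) (hg : ContDiff ℝ ∞ g)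
    (hg1 : ∀ x, g (x + r • u x) = x) (hg2 : ∀ x, g x + r • u (g x) = x) :
    IsSymplectomorphism fun x => g x + s • u (g x) := by
  have hsu : ContDiff ℝ ∞ fun x => s • u x := hu.const_smul s
  have hud : Differentiable ℝ u := hu.differentiable (by simp)
  -- Exchanging the roles of `r` and `s` gives the inverse map `(id + r u) ∘ f`.
  obtain ⟨f, hf, hf1, hf2⟩ := exists_contDiff_inverse_id_add hsu fun x => by
    rw [fderiv_fun_const_smul (hud x), norm_smul, Real.norm_of_nonneg hs0]
    exact (mul_le_of_le_one_left (norm_nonneg _) hs1).trans (hb x)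
  have h0c : ∀ c : ℝ, ∀ x ∉ disc n, c • u x = 0 := fun c x hx => by rw [h0 x hx, smul_zero]
  have hφ : ContDiff ℝ ∞ fun x => g x + s • u (g x) := hg.add (hsu.comp hg)
  refine ⟨fun x hx => mapsTo_disc_id_add (h0c s) hf1 (mapsTo_disc_inverse_id_add (h0c r) hg2 hx),
    hφ.contDiffOn, ⟨fun x => f x + r • u (f x), fun x hx => mapsTo_disc_id_add (h0c r) hg1
      (mapsTo_disc_inverse_id_add (h0c s) hf2 hx), ?_, fun x _ => ?_, fun x _ => ?_⟩,
    fun x hx a b => ?_⟩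
  · exact (hf.add ((hu.const_smul r).comp hf)).contDiffOn
  · simp only [hf1, hg2]
  · simp only [hg1, hf2]
  · have hdg : HasFDerivAt g (fderiv ℝ g x) x := (hg.differentiable (by simp) x).hasFDerivAt
    have hdu : HasFDerivAt (fun x => u (g x)) ((fderiv ℝ u (g x)).comp (fderiv ℝ g x)) x :=
      (hud (g x)).hasFDerivAt.comp x hdg
    have hF := hdg.add (hdu.const_smul s)
    have hG := hdg.add (hdu.const_smul r)
    have hG' := hG.unique ((hasFDerivAt_id x).congr_of_eventuallyEq
      (Filter.Eventually.of_forall hg2))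
    have hid : ∀ v, fderiv ℝ g x v + r • fderiv ℝ u (g x) (fderiv ℝ g x v) = v := fun v =>
      DFunLike.congr_fun hG' v
    have hF' := (hF.hasFDerivWithinAt (s := disc n)).fderivWithin (uniqueDiffOn_disc x hx)
    have hFv : ∀ v, fderivWithin ℝ (fun x => g x + s • u (g x)) (disc n) x v =
        fderiv ℝ g x v + s • fderiv ℝ u (g x) (fderiv ℝ g x v) := fun v =>
      DFunLike.congr_fun hF' v
    rw [hFv, hFv]
    conv_rhs => rw [← hid a, ← hid b]
    rw [omega_add_smul, omega_add_smul]
    obtain rfl : r = 1 - s := by linarith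
    -- Both `s - r` and `s² - r²` equal `2 * s - 1` when `r + s = 1`.
    linear_combination (2 * s - 1) * hω (g x) (fderiv ℝ g x a) (fderiv ℝ g x b)

/-- The infinitesimal form of the symplectic condition for `id + u`. -/
theorem omega_displacement {φ₀ u : Space n → Space n} (hs : IsSymplectomorphism φ₀)
    (hu : ContDiff ℝ ∞ u) (hφ : EqOn u (fun x => φ₀ x - x) (disc n)) (h0 : ∀ x ∉ disc n, u x = 0)
    (x a b : Space n) : omega (fderiv ℝ u x a) b + omega a (fderiv ℝ u x b) +
      omega (fderiv ℝ u x a) (fderiv ℝ u x b) = 0 := by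
  by_cases hx : x ∈ disc n
  · have hd := ((hasFDerivAt_id x).add
      (hu.differentiable (by simp) x).hasFDerivAt).hasFDerivWithinAt (s := disc n)
    have hd' := (hd.congr (f₁ := φ₀) (fun y hy => by simp [hφ hy])
      (by simp [hφ hx])).fderivWithin (uniqueDiffOn_disc x hx)
    have h := hs.preserves_omega x hx a b
    have hv : ∀ v, fderivWithin ℝ φ₀ (disc n) x v = v + (1 : ℝ) • fderiv ℝ u x v := fun v => by
      rw [hd', one_smul]; rfl
    rw [hv, hv, omega_add_smul] at h
    linarith
  · have h1 : fderiv ℝ u x = 0 := by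
      rw [← norm_eq_zero, ← norm_iteratedFDeriv_one, iteratedFDeriv_eq_zero_of_notMem_disc h0 hx,
        norm_zero]
    simp [h1, omega]

/-- Closeness on the disc becomes a bound on the whole space, where the global inverse theorem
applies. -/
theorem norm_iteratedFDeriv_displacement_le {φ₀ u : Space n → Space n} {m : ℕ} {δ : ℝ}
    (hδ : 0 ≤ δ) (hc : CkClose m δ (disc n) φ₀ id) (hu : ContDiff ℝ ∞ u)
    (hφ : EqOn u (fun x => φ₀ x - x) (disc n)) (h0 : ∀ x ∉ disc n, u x = 0)
    {j : ℕ} (hj : j ≤ m) (x : Space n) : ‖iteratedFDeriv ℝ j u x‖ ≤ δ := by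
  by_cases hx : x ∈ disc n
  · rw [← iteratedFDerivWithin_eq_iteratedFDeriv uniqueDiffOn_disc
      (hu.of_le (mod_cast le_top)).contDiffAt hx, iteratedFDerivWithin_congr hφ hx]
    exact (hc j hj x hx).le
  · rwa [iteratedFDeriv_eq_zero_of_notMem_disc h0 hx, norm_zero]

end SymplecticDisc

/-! ### Time cutoff and construction of the family. -/

theorem norm_iteratedFDeriv_const_le {E F : Type*} [NormedAddCommGroup E] [NormedSpace ℝ E]
    [NormedAddCommGroup F] [NormedSpace ℝ F] (c : F) (j : ℕ) (x : E) :
    ‖iteratedFDeriv ℝ j (fun _ : E => c) x‖ ≤ ‖c‖ := by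
  cases j with
  | zero => simp
  | succ j => simp [iteratedFDeriv_succ_const]

/-- A smooth cutoff in time with bounded derivatives. -/
theorem exists_time_cutoff (k : ℕ) : ∃ (l : ℝ → ℝ) (R : ℝ), ContDiff ℝ ∞ l ∧
    (∀ t, 0 ≤ l t ∧ l t ≤ 1) ∧ (∀ t ∈ Icc (0 : ℝ) (1 / 3), l t = 1) ∧
    (∀ t ∈ Icc (2 / 3 : ℝ) 1, l t = 0) ∧ 0 ≤ R ∧
    (∀ j ≤ k, ∀ t, ‖iteratedFDeriv ℝ j l t‖ ≤ R) ∧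
    ∀ j ≤ k, ∀ t, ‖iteratedFDeriv ℝ j (fun t => 1 / 2 - (1 / 2 : ℝ) • l t) t‖ ≤ 1 + R := by
  let b : ContDiffBump (0 : ℝ) := ⟨1 / 3, 2 / 3, by norm_num, by norm_num⟩
  have hb : ContDiff ℝ ∞ b := b.contDiff
  obtain ⟨R, hR0, hR⟩ := exists_bound_iteratedFDeriv_of_hasCompactSupport hb b.hasCompactSupport k
  refine ⟨b, R, hb, fun t => ⟨b.nonneg, b.le_one⟩, fun t ht => b.one_of_mem_closedBall ?_,
    fun t ht => b.zero_of_le_dist ?_, hR0, hR, fun j hj t => ?_⟩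
  · rw [Metric.mem_closedBall, Real.dist_eq, sub_zero, abs_of_nonneg ht.1]; exact ht.2
  · rw [Real.dist_eq, sub_zero, abs_of_nonneg (by linarith [ht.1])]; exact ht.1
  · have hbj : ContDiffAt ℝ j b t := (hb.of_le (mod_cast le_top)).contDiffAt
    have hbj' : ContDiffAt ℝ j (fun t => (1 / 2 : ℝ) • b t) t := hbj.const_smul _
    rw [fun_iteratedFDeriv_sub_apply contDiffAt_const hbj']
    refine (norm_sub_le _ _).trans (add_le_add
      ((norm_iteratedFDeriv_const_le _ j t).trans (by norm_num)) ?_)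
    have h : iteratedFDeriv ℝ j (fun t => (1 / 2 : ℝ) • b t) t =
        (1 / 2 : ℝ) • iteratedFDeriv ℝ j b t := iteratedFDeriv_const_smul_apply' hbj
    rw [h, norm_smul, Real.norm_of_nonneg (by norm_num)]
    linarith [hR j hj t]

theorem mainTheorem5 (n : ℕ) (hn : 1 ≤ n) (k : ℕ) (ε : ℝ) (hε : 0 < ε) :
    ∃ (m : ℕ) (δ : ℝ), 0 < δ ∧
      ∀ φ₀ : SymplecticDisc.Space n → SymplecticDisc.Space n,
        SymplecticDisc.IsSymplectomorphism φ₀ →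
        (∃ U ∈ 𝓝ˢ (SymplecticDisc.bdry n), EqOn φ₀ id (U ∩ SymplecticDisc.disc n)) →
        SymplecticDisc.CkClose m δ (SymplecticDisc.disc n) φ₀ id →
        ∃ φ : ℝ → SymplecticDisc.Space n → SymplecticDisc.Space n,
          ContDiffOn ℝ ∞ (fun p : ℝ × SymplecticDisc.Space n => φ p.1 p.2)
            (Icc (0 : ℝ) 1 ×ˢ SymplecticDisc.disc n) ∧
          (∀ t ∈ Icc (0 : ℝ) 1, SymplecticDisc.IsSymplectomorphism (φ t)) ∧
          (∃ U ∈ 𝓝ˢ (SymplecticDisc.bdry n), ∀ t ∈ Icc (0 : ℝ) 1,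
            EqOn (φ t) id (U ∩ SymplecticDisc.disc n)) ∧
          (∀ t ∈ Icc (0 : ℝ) (1 / 3), EqOn (φ t) φ₀ (SymplecticDisc.disc n)) ∧
          (∀ t ∈ Icc (2 / 3 : ℝ) 1, EqOn (φ t) id (SymplecticDisc.disc n)) ∧
          SymplecticDisc.CkClose k ε (Icc (0 : ℝ) 1 ×ˢ SymplecticDisc.disc n)
            (fun p : ℝ × SymplecticDisc.Space n => φ p.1 p.2) (fun p => p.2) := by
  obtain ⟨C, hC1, hC⟩ :=
    exists_bound_iteratedFDeriv_inverse (ℝ × SymplecticDisc.Space n) k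
  obtain ⟨l, R, hl, hl01, hl1, hl0, hR0, hlR, hrR⟩ := exists_time_cutoff (k + 1)
  set r : ℝ → ℝ := fun t => 1 / 2 - (1 / 2 : ℝ) • l t with hr
  have hrs : ContDiff ℝ ∞ r := contDiff_const.sub (hl.const_smul _)
  -- The factor `2 ^ (k + 1) * (1 + R)` comes from the product estimate for `ρ(t) • u(x)`, and `k! *
  -- C ^ k` from composition with `Γ`.
  set K : ℝ := 2 ^ (k + 1) * (1 + R) * k.factorial * C ^ k with hK
  have hCk : 1 ≤ C ^ k := one_le_pow₀ hC1
  have hfac : (1 : ℝ) ≤ k.factorial := mod_cast Nat.one_le_iff_ne_zero.2 k.factorial_ne_zero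
  have h2k : (1 : ℝ) ≤ 2 ^ (k + 1) := one_le_pow₀ one_le_two
  have hK1 : 2 ^ (k + 1) * (1 + R) ≤ K :=
    (le_mul_of_one_le_right (by positivity) hfac).trans
      (le_mul_of_one_le_right (by positivity) hCk)
  have hK0 : 1 ≤ K := (one_le_mul_of_one_le_of_one_le h2k (by linarith)).trans hK1
  have hKpos : 0 < K := by linarith
  -- This makes `K * δ` both at most `1/2`, for inverting, and less than `ε`, for the conclusion.
  set δ : ℝ := min 1 ε / (2 * K) with hδ
  have hmin : 0 < min 1 ε := lt_min one_pos hε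
  have hδ0 : 0 < δ := by positivity
  have hKδ : K * δ = min 1 ε / 2 := by rw [hδ]; field_simp
  have hKδ1 : K * δ ≤ 1 / 2 := by rw [hKδ]; linarith [min_le_left 1 ε]
  have hKδε : K * δ < ε := by rw [hKδ]; linarith [min_le_right 1 ε]
  -- One derivative beyond `k` is what the bound on the inverse needs; it also covers the slope of
  -- `u` when `k = 0`.
  refine ⟨k + 1, δ, hδ0, fun φ₀ hφ₀ ⟨U, hU, hUφ⟩ hclose => ?_⟩
  obtain ⟨u, hu, huφ, hu0⟩ := SymplecticDisc.exists_contDiff_displacement hφ₀.smooth hU hUφ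
  have huδ : ∀ j ≤ k + 1, ∀ x, ‖iteratedFDeriv ℝ j u x‖ ≤ δ := fun j hj x =>
    SymplecticDisc.norm_iteratedFDeriv_displacement_le hδ0.le hclose hu huφ hu0 hj x
  have hub : ∀ x, ‖fderiv ℝ u x‖ ≤ 1 / 2 := fun x => by
    rw [← norm_iteratedFDeriv_one]
    exact (huδ 1 (by omega) x).trans ((le_mul_of_one_le_left hδ0.le hK0).trans hKδ1)
  let V : ℝ × SymplecticDisc.Space n → SymplecticDisc.Space n := fun p => r p.1 • u p.2
  -- Inverting on space-time makes `(id + r(t) u)⁻¹` jointly smooth in `(t, x)` and bounds its time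
  -- derivatives as well.
  let W : ℝ × SymplecticDisc.Space n → ℝ × SymplecticDisc.Space n := fun p => (0, V p)
  have hV : ContDiff ℝ ∞ V := (hrs.comp contDiff_fst).smul (hu.comp contDiff_snd)
  have hW : ContDiff ℝ ∞ W := contDiff_const.prodMk hV
  have hWb : ∀ j ≤ k + 1, ∀ p, ‖iteratedFDeriv ℝ j W p‖ ≤ 1 / 2 := fun j hj p => by
    have h1 := (ContinuousLinearMap.inr ℝ ℝ (SymplecticDisc.Space n)).norm_iteratedFDeriv_comp_left
      hV.contDiffAt (x := p) (n := j) (mod_cast le_top)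
    have h2 := norm_iteratedFDeriv_fst_smul_snd_le hrs hu hrR huδ hj p
    have h3 : (2 : ℝ) ^ j * ((1 + R) * δ) ≤ 2 ^ (k + 1) * ((1 + R) * δ) := by
      gcongr
      norm_num
    have h4 : 2 ^ (k + 1) * (1 + R) * δ ≤ K * δ := by gcongr
    refine h1.trans ((mul_le_of_le_one_left (norm_nonneg _)
      (ContinuousLinearMap.norm_inr_le_one ..)).trans (h2.trans (h3.trans ?_)))
    linarith
  obtain ⟨Γ, hΓ, hΓ1, hΓ2⟩ := exists_contDiff_inverse_id_add hW fun p => by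
    rw [← norm_iteratedFDeriv_one]; exact hWb 1 (by omega) p
  have hΓfst : ∀ p, (Γ p).1 = p.1 := fun p => by simpa [W] using congrArg Prod.fst (hΓ2 p)
  have hΓsnd : ∀ p, (Γ p).2 + r p.1 • u (Γ p).2 = p.2 := fun p => by
    simpa [W, V, hΓfst] using congrArg Prod.snd (hΓ2 p)
  have hg1 : ∀ t x, (Γ (t, x + r t • u x)).2 = x := fun t x => by
    simpa [W, V] using congrArg Prod.snd (hΓ1 (t, x))
  -- Here `s - r = 1 - 2 r = l`, so the displacement is `l • u` composed with `Γ`.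
  have hdisp : ∀ p : ℝ × SymplecticDisc.Space n,
      (Γ p).2 + (1 - r p.1) • u (Γ p).2 = p.2 + l p.1 • u (Γ p).2 := fun p => by
    conv_rhs => rw [← hΓsnd p]
    rw [add_assoc, ← add_smul]
    congr 2
    simp only [hr, smul_eq_mul]
    ring
  have hfix : ∀ t x, u x = 0 → (Γ (t, x)).2 = x := fun t x hx => by
    simpa [hx] using hg1 t x
  have hr01 : ∀ t, 0 ≤ 1 - r t ∧ 1 - r t ≤ 1 := fun t => by
    have := hl01 t
    simp only [hr, smul_eq_mul]
    constructor <;> linarith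
  have hu2 : ContDiff ℝ ∞ fun p => u (Γ p).2 := hu.comp (contDiff_snd.comp hΓ)
  refine ⟨fun t x => (Γ (t, x)).2 + (1 - r t) • u (Γ (t, x)).2, ?_, fun t _ => ?_,
    ⟨U, hU, fun t _ x hx => ?_⟩, fun t ht x hx => ?_, fun t ht x _ => ?_, fun j hj p hp => ?_⟩
  · exact ((contDiff_snd.comp hΓ).add
      ((contDiff_const.sub (hrs.comp contDiff_fst)).smul hu2)).contDiffOn
  · exact SymplecticDisc.isSymplectomorphism_interpolation (g := fun x => (Γ (t, x)).2) hu hu0 hub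
      (SymplecticDisc.omega_displacement hφ₀ hu huφ hu0) (hr01 t).1 (hr01 t).2
      (add_sub_cancel _ _) (contDiff_snd.comp (hΓ.comp (contDiff_prodMk_right t))) (hg1 t)
      fun x => hΓsnd (t, x)
  -- Zeros of `u` are fixed for every `t`, so the neighborhood `U` given for `φ₀` serves all times.
  · have h0 : u x = 0 := (huφ hx.2).trans (sub_eq_zero.2 (hUφ hx))
    simp only [hfix t x h0, h0, smul_zero, add_zero, id]
  · have hrt : r t = 0 := by simp [hr, hl1 t ht]
    have h := hg1 t x
    rw [hrt, zero_smul, add_zero] at h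
    simp only [h, hrt, sub_zero, one_smul]
    rw [huφ hx, add_sub_cancel]
  · have h := hdisp (t, x)
    simp only [hl0 t ht, zero_smul, add_zero] at h
    exact h
  · have heq : (fun p : ℝ × SymplecticDisc.Space n =>
        (Γ (p.1, p.2)).2 + (1 - r p.1) • u (Γ (p.1, p.2)).2 - p.2) =
        (fun p : ℝ × SymplecticDisc.Space n => l p.1 • u p.2) ∘ Γ := by
      funext p
      rw [Prod.mk.eta, hdisp p, add_sub_cancel_left, Function.comp_apply, hΓfst]
    have hlu : ContDiff ℝ ∞ (fun p : ℝ × SymplecticDisc.Space n => l p.1 • u p.2) :=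
      (hl.comp contDiff_fst).smul (hu.comp contDiff_snd)
    rw [heq, iteratedFDerivWithin_eq_iteratedFDeriv
      ((uniqueDiffOn_Icc zero_lt_one).prod SymplecticDisc.uniqueDiffOn_disc)
      ((hlu.comp hΓ).of_le (mod_cast le_top)).contDiffAt hp]
    refine lt_of_le_of_lt (norm_iteratedFDeriv_comp_le hlu hΓ (mod_cast le_top) p
      (C := 2 ^ (k + 1) * ((1 + R) * δ)) (D := C) (fun i hi => ?_)
      fun i hi1 hi => (hC W Γ hW hΓ hΓ2 hWb i hi1 (hi.trans hj) p).trans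
        (le_self_pow₀ hC1 (by omega))) (lt_of_le_of_lt ?_ hKδε)
    · refine (norm_iteratedFDeriv_fst_smul_snd_le hl hu hlR huδ
        ((hi.trans hj).trans k.le_succ) _).trans ?_
      gcongr
      · norm_num
      · omega
      · linarith
    · calc (j.factorial : ℝ) * (2 ^ (k + 1) * ((1 + R) * δ)) * C ^ j
          ≤ k.factorial * (2 ^ (k + 1) * ((1 + R) * δ)) * C ^ k := by
            gcongr
        _ = K * δ := by rw [hK]; ring
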